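/- Let $\mathbb{K}$ be a field, let $G$ be a finite simple graph with vertex set $V(G)=\{v_1,\dots,v_n\}$, let $S=\mathbb{K}[x_1,\dots,x_n]$, and let $I=I(G)\subseteq S$ be the edge ideal of $G$, generated by the monomials $x_ix_j$ with $\{v_i,v_j\}$ an edge of $G$. Let $p$ be the number of connected components of $G$ that are bipartite (isolated vertices count as bipartite components). Then for every integer $k\ge 0$, $$\operatorname{sdepth}(I^k/I^{k+1})\ge p .$$ Here, for a finitely generated $\mathbb{Z}^n$-graded $S$-module $M$, a Stanley decomposition of $M$ is a finite direct sum decomposition $\mathcal{D}: M=\bigoplus_{i=1}^r u_i\mathbb{K}[Z_i]$ of $M$ as a $\mathbb{K}$-vector space, where each $u_i\in M$ is homogeneous, $Z_i\subseteq\{x_1,\dots,x_n\}$, and $u_i\mathbb{K}[Z_i]$ is a free $\mathbb{K}[Z_i]$-module with basis $u_i$; one sets $\operatorname{sdepth}(\mathcal{D})=\min_i|Z_i|$ and $\operatorname{sdepth}(M)=\max_{\mathcal{D}}\operatorname{sdepth}(\mathcal{D})$, with $\operatorname{sdepth}(0)=\infty$. The module $I^k/I^{k+1}$ carries the $\mathbb{Z}^n$-grading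 inherited from $S$. -/

import Mathlib

open MvPolynomial

noncomputable section

section Stanley

variable {σ K M : Type*} [Field K] [AddCommGroup M] [Module K M] [Module (MvPolynomial σ K) M]
  [IsScalarTower K (MvPolynomial σ K) M]

/-- The `K`-subspace `u K[Z]` of an `S`-module `M`, where `S = K[x_i : i ∈ σ]`, `u ∈ M` and `Z` is
a set of variables: all products of `u` with a polynomial in the variables of `Z` only. -/
def stanleySpace (u : M) (Z : Finset σ) : Submodule K M :=
  (Subalgebra.toSubmodule (supported K (Z : Set σ))).map
    ((LinearMap.toSpanSingleton (MvPolynomial σ K) M u).restrictScalars K)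

/-- A Stanley decomposition of a `ℤ^n`-graded module `M` over the polynomial ring
`S = K[x_i : i ∈ σ]`; here `𝓜 a` is the homogeneous component of `M` of multidegree `a`. It is a
finite direct sum decomposition of the `K`-space `M` into Stanley spaces `u K[Z]`, with `u`
homogeneous and `u K[Z]` free over `K[Z]` (on the generator `u`). -/
structure StanleyDecomposition (𝓜 : (σ →₀ ℤ) → Submodule K M) where
  /-- the number of summands -/
  r : ℕ
  /-- the generators -/
  u : Fin r → M
  /-- the sets of variables -/
  Z : Fin r → Finset σ
  homogeneous : ∀ i, ∃ a, u i ∈ 𝓜 a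
  free : ∀ i, ∀ f ∈ supported K (Z i : Set σ), f • u i = 0 → f = 0
  isInternal : DirectSum.IsInternal fun i => stanleySpace (K := K) (u i) (Z i)

/-- The Stanley depth of a Stanley decomposition: the minimum of the dimensions `|Z i|`
(`⊤` for the empty decomposition, which occurs only for the zero module). -/
def StanleyDecomposition.sdepth {𝓜 : (σ →₀ ℤ) → Submodule K M}
    (D : StanleyDecomposition 𝓜) : ℕ∞ :=
  ⨅ i, ((D.Z i).card : ℕ∞)

/-- The Stanley depth of a `ℤ^n`-graded module: the maximum of the Stanley depths of its Stanley
decompositions (`⊤` for the zero module). -/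
def sdepth (𝓜 : (σ →₀ ℤ) → Submodule K M) : ℕ∞ :=
  ⨆ D : StanleyDecomposition 𝓜, D.sdepth

end Stanley

section EdgeIdeal

variable {V : Type*}

/-- The edge ideal of a graph `G`, generated by the monomials `x_v x_w` for the edges `vw`. -/
def edgeIdeal (K : Type*) [Field K] (G : SimpleGraph V) : Ideal (MvPolynomial V K) :=
  Ideal.span {f | ∃ v w, G.Adj v w ∧ f = X v * X w}

/-- The number of connected components of `G` that are bipartite graphs
(a single vertex is a bipartite graph). -/
def numBipartiteComponents (G : SimpleGraph V) : ℕ :=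
  Nat.card {C : G.ConnectedComponent // C.toSimpleGraph.IsBipartite}

variable {K : Type*} [Field K]

/-- For ideals `L ⊆ J`, the module `J / L`. -/
abbrev IdealQuot (J L : Ideal (MvPolynomial V K)) : Type _ :=
  J ⧸ Submodule.comap J.subtype L

/-- The multigrading of `J / L` inherited from the polynomial ring: the component of degree `a`
consists of the classes of the elements of `J` that are homogeneous of multidegree `a`, where the
variable `x_v` has multidegree the unit vector at `v`. -/
def quotGrading (J L : Ideal (MvPolynomial V K)) (a : V →₀ ℤ) :
    Submodule K (IdealQuot J L) :=
  ((weightedHomogeneousSubmodule K (fun v : V => Finsupp.single v (1 : ℤ)) a).comap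
    (J.subtype.restrictScalars K)).map ((Submodule.comap J.subtype L).mkQ.restrictScalars K)

end EdgeIdeal

end

/-! A monomial `x ^ a` lies in `I ^ k` but not in `I ^ (k + 1)` exactly when its order along `I`,
the number of edges one can take out of the exponent vector `a`, is `k`. A partition of these
exponent vectors into boxes with `p` free directions is a Stanley decomposition of
`I ^ k / I ^ (k + 1)` of depth `p`.

The order is the sum of the orders on the connected components, so it is enough to partition the
exponents of each order on each component and to take products: one free direction is needed on a
bipartite component and none on the others. On a bipartite component, an augmenting path argument
shows that every exponent vector admits a vertex along which it can be increased arbitrarily without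
changing its order. The exponent vectors of a given order form a convex set determined by truncated
coordinates, and such a set, having a free direction at each of its points, is a finite disjoint
union of boxes with a free direction. -/

open scoped Pointwise Finset

section BoxPartition

variable {V : Type*}

/-- The box of all exponent vectors above `u` that agree with `u` in the coordinates of `F`; the
coordinates outside `F` are its free directions. -/
def box (u : V →₀ ℕ) (F : Finset V) : Set (V →₀ ℕ) :=
  {a | u ≤ a ∧ ∀ v ∈ F, a v = u v}

/-- `BoxPartition C d A` says that `A` is a finite disjoint union of boxes that are cylinders over
the coordinates of `C` and have at least `d` free directions in `C`. -/
inductive BoxPartition (C : Finset V) (d : ℕ) : Set (V →₀ ℕ) → Prop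
  | empty : BoxPartition C d ∅
  | of_box {u : V →₀ ℕ} {F : Finset V} (hu : u.support ⊆ C) (hF : F ⊆ C) (hd : #F + d ≤ #C) :
      BoxPartition C d (box u F)
  | union {A B : Set (V →₀ ℕ)} (h : Disjoint A B) (hA : BoxPartition C d A)
      (hB : BoxPartition C d B) : BoxPartition C d (A ∪ B)

theorem add_mem_box_iff [Fintype V] [DecidableEq V] {a b : V →₀ ℕ} {F : Finset V} :
    b + a ∈ box a F ↔ b.support ⊆ Fᶜ := by
  simp [box, Finset.disjoint_right, Finset.subset_compl_iff_disjoint_right]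

theorem box_inter_box [DecidableEq V] {u u' : V →₀ ℕ} {F F' : Finset V}
    (h : Disjoint F u'.support) (h' : Disjoint F' u.support) :
    box u F ∩ box u' F' = box (u ⊔ u') (F ∪ F') := by
  have hu : ∀ v ∈ F, (u ⊔ u') v = u v := fun v hv => by
    simp [Finsupp.notMem_support_iff.1 (Finset.disjoint_left.1 h hv)]
  have hu' : ∀ v ∈ F', (u ⊔ u') v = u' v := fun v hv => by
    simp [Finsupp.notMem_support_iff.1 (Finset.disjoint_left.1 h' hv)]
  ext a
  simp only [box, Set.mem_inter_iff, Set.mem_ofPred_eq, sup_le_iff, Finset.mem_union]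
  grind

theorem BoxPartition.inter [DecidableEq V] {C C' : Finset V} (h : Disjoint C C') {d d' : ℕ}
    {A B : Set (V →₀ ℕ)} (hA : BoxPartition C d A) (hB : BoxPartition C' d' B) :
    BoxPartition (C ∪ C') (d + d') (A ∩ B) := by
  induction hA with
  | empty => simpa only [Set.empty_inter] using .empty
  | union hd _ _ ih₁ ih₂ =>
    rw [Set.union_inter_distrib_right]
    exact .union (hd.mono Set.inter_subset_left Set.inter_subset_left) ih₁ ih₂
  | @of_box u F hu hF hd =>
    induction hB with
    | empty => simpa only [Set.inter_empty] using .empty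
    | union hd' _ _ ih₁ ih₂ =>
      rw [Set.inter_union_distrib_left]
      exact .union (hd'.mono Set.inter_subset_right Set.inter_subset_right) ih₁ ih₂
    | @of_box u' F' hu' hF' hd' =>
      rw [box_inter_box (h.mono hF hu') (h.symm.mono hF' hu)]
      refine .of_box ?_ (Finset.union_subset_union hF hF') ?_
      · rw [Finsupp.support_sup]
        exact Finset.union_subset_union hu hu'
      · rw [Finset.card_union_of_disjoint h, Finset.card_union_of_disjoint (h.mono hF hF')]
        omega

theorem BoxPartition.biInter [DecidableEq V] {ι : Type*} {s : Finset ι} {C : ι → Finset V}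
    {d : ι → ℕ} {A : ι → Set (V →₀ ℕ)} (hC : (s : Set ι).PairwiseDisjoint C)
    (hA : ∀ i ∈ s, BoxPartition (C i) (d i) (A i)) :
    BoxPartition (s.biUnion C) (∑ i ∈ s, d i) (⋂ i ∈ s, A i) := by
  classical
  induction s using Finset.induction_on with
  | empty =>
    have huniv : box (0 : V →₀ ℕ) ∅ = Set.univ := by simp [box]
    simpa [huniv] using BoxPartition.of_box (C := ∅) (d := 0) (u := (0 : V →₀ ℕ)) (F := ∅)
  | insert i s hi ih =>
    rw [Finset.coe_insert, Set.pairwiseDisjoint_insert_of_notMem (by simpa using hi)] at hC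
    rw [Finset.biUnion_insert, Finset.sum_insert hi, Finset.set_biInter_insert]
    exact (hA i (Finset.mem_insert_self i s)).inter ((Finset.disjoint_biUnion_right _ _ _).2 hC.2)
      (ih hC.1 fun j hj => hA j (Finset.mem_insert_of_mem hj))

theorem BoxPartition.biUnion {ι : Type*} {C : Finset V} {d : ℕ} {s : Finset ι}
    {A : ι → Set (V →₀ ℕ)} (hd : (s : Set ι).PairwiseDisjoint A)
    (hA : ∀ i ∈ s, BoxPartition C d (A i)) : BoxPartition C d (⋃ i ∈ s, A i) := by
  classical
  induction s using Finset.induction_on with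
  | empty => simpa using BoxPartition.empty
  | insert i s hi ih =>
    rw [Finset.coe_insert, Set.pairwiseDisjoint_insert_of_notMem (by simpa using hi)] at hd
    rw [Finset.set_biUnion_insert]
    exact .union (Set.disjoint_iUnion₂_right.2 hd.2) (hA i (Finset.mem_insert_self i s))
      (ih hd.1 fun j hj => hA j (Finset.mem_insert_of_mem hj))

theorem BoxPartition.exists_boxes {C : Finset V} {d : ℕ} {A : Set (V →₀ ℕ)}
    (hA : BoxPartition C d A) :
    ∃ (r : ℕ) (u : Fin r → V →₀ ℕ) (F : Fin r → Finset V), (∀ i, #(F i) + d ≤ #C) ∧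
      Pairwise (Function.onFun Disjoint fun i => box (u i) (F i)) ∧
      ⋃ i, box (u i) (F i) = A := by
  induction hA with
  | empty => exact ⟨0, Fin.elim0, Fin.elim0, by simp, Subsingleton.pairwise, by simp⟩
  | @of_box u F _ _ hd =>
    exact ⟨1, fun _ => u, fun _ => F, fun _ => hd, Subsingleton.pairwise, Set.iUnion_const _⟩
  | @union A B hdisj _ _ ihA ihB =>
    obtain ⟨r, u, F, hF, hpw, rfl⟩ := ihA
    obtain ⟨r', u', F', hF', hpw', rfl⟩ := ihB
    have hcross : ∀ i j, Disjoint (box (u i) (F i)) (box (u' j) (F' j)) := fun i j =>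
      hdisj.mono (Set.subset_iUnion (fun i => box (u i) (F i)) i)
        (Set.subset_iUnion (fun j => box (u' j) (F' j)) j)
    let e : Fin (r + r') ≃ Fin r ⊕ Fin r' := finSumFinEquiv.symm
    have hsum : Pairwise (Function.onFun Disjoint fun i : Fin r ⊕ Fin r' =>
        box (Sum.elim u u' i) (Sum.elim F F' i)) := by
      rintro (i | i) (j | j) hij
      · exact hpw (by simpa using hij)
      · exact hcross i j
      · exact (hcross j i).symm
      · exact hpw' (by simpa using hij)
    refine ⟨r + r', Sum.elim u u' ∘ e, Sum.elim F F' ∘ e, fun i => ?_,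
      hsum.comp_of_injective e.injective, ?_⟩
    · exact Sum.rec (motive := fun j => #(Sum.elim F F' j) + d ≤ #C) hF hF' (e i)
    · exact (e.surjective.iUnion_comp fun i => box (Sum.elim u u' i) (Sum.elim F F' i)).trans
        (by simp [Set.iUnion_sum])

/-- Membership in `A` depends only on the exponents truncated at `n`. -/
def DeterminedBy (n : V →₀ ℕ) (A : Set (V →₀ ℕ)) : Prop :=
  ∀ a, a ⊓ n ∈ A ↔ a ∈ A

variable {n : V →₀ ℕ} {A : Set (V →₀ ℕ)} {C : Finset V}

theorem DeterminedBy.mem_congr (hA : DeterminedBy n A) {a b : V →₀ ℕ} (hab : a ⊓ n = b ⊓ n) :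
    a ∈ A ↔ b ∈ A := by
  rw [← hA a, hab, hA b]

theorem mem_box_iff_inf_eq {a g : V →₀ ℕ} (hg : g ≤ n) :
    a ∈ box g (n - g).support ↔ a ⊓ n = g := by
  simp only [box, Set.mem_ofPred_eq, Finsupp.le_def, Finsupp.mem_support_iff, Finsupp.ext_iff,
    Finsupp.coe_tsub, Pi.sub_apply, Finsupp.inf_apply, ← forall_and]
  refine forall_congr' fun v => ?_
  grind [hg v]

theorem DeterminedBy.boxPartition_zero (hA : DeterminedBy n A) (hn : n.support ⊆ C) :
    BoxPartition C 0 A := by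
  classical
  have hcells : A = ⋃ g ∈ {g ∈ Finset.Iic n | g ∈ A}, box g (n - g).support := by
    ext a
    simp only [Finset.mem_filter, Finset.mem_Iic, Set.mem_iUnion, exists_prop]
    constructor
    · exact fun ha => ⟨a ⊓ n, ⟨inf_le_right, (hA a).2 ha⟩, (mem_box_iff_inf_eq inf_le_right).2 rfl⟩
    · rintro ⟨g, ⟨hgn, hgA⟩, hag⟩
      rwa [← hA, (mem_box_iff_inf_eq hgn).1 hag]
  rw [hcells]
  refine .biUnion (fun g hg g' hg' hne => Set.disjoint_left.2 fun a ha ha' => hne ?_)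
    fun g hg => ?_
  · simp only [Finset.coe_filter, Finset.mem_Iic, Set.mem_ofPred_eq] at hg hg'
    rw [← (mem_box_iff_inf_eq hg.1).1 ha, ← (mem_box_iff_inf_eq hg'.1).1 ha']
  · have hgn : g ≤ n := Finset.mem_Iic.1 (Finset.mem_filter.1 hg).1
    have hF : (n - g).support ⊆ C := (Finsupp.support_mono tsub_le_self).trans hn
    exact .of_box ((Finsupp.support_mono hgn).trans hn) hF (Finset.card_le_card hF)

theorem mem_box_erase_iff [DecidableEq V] {a g : V →₀ ℕ} (hg : g ≤ n) {i : V} :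
    a ∈ box g ((n - g).support.erase i) ↔ g i ≤ a i ∧ ∀ v ≠ i, (a ⊓ n) v = g v := by
  simp only [box, Set.mem_ofPred_eq, Finsupp.le_def, Finset.mem_erase, Finsupp.mem_support_iff,
    Finsupp.coe_tsub, Pi.sub_apply, Finsupp.inf_apply]
  constructor
  · refine fun ⟨hle, heq⟩ => ⟨hle i, fun v hv => ?_⟩
    grind [hle v, hg v, heq v]
  · refine fun ⟨hi, heq⟩ => ⟨fun v => ?_, fun v hv => ?_⟩
    · by_cases hv : v = i
      · exact hv ▸ hi
      · exact (heq v hv).symm.le.trans (min_le_left _ _)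
    · grind [hg v, heq v hv.1]

/-- The bottom points, below `n`, of the lines in direction `i` that meet `A`. -/
def lineBottoms (n : V →₀ ℕ) (A : Set (V →₀ ℕ)) (i : V) : Set (V →₀ ℕ) :=
  {g | g ≤ n ∧ g ∈ A ∧ ∀ j, g.update i j ∈ A → g i ≤ j}

theorem DeterminedBy.iUnion_lineBottoms [DecidableEq V] (hA : DeterminedBy n A) {i : V}
    (hadd : ∀ a ∈ A, ∀ j, a + Finsupp.single i j ∈ A) :
    ⋃ g ∈ lineBottoms n A i, box g ((n - g).support.erase i) = A := by
  ext a
  simp only [Set.mem_iUnion, exists_prop]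
  constructor
  · rintro ⟨g, ⟨hgn, hgA, -⟩, hag⟩
    obtain ⟨hle, heq⟩ := (mem_box_erase_iff hgn).1 hag
    refine (hA.mem_congr (Finsupp.ext fun v => ?_)).1 (hadd g hgA (a i - g i))
    by_cases hv : v = i
    · subst hv
      simp [hle]
    · simpa [Finsupp.single_apply, Ne.symm hv, heq v hv] using hgn v
  · intro ha
    classical
    have hself : (a ⊓ n).update i ((a ⊓ n) i) ∈ A := by
      rw [Finsupp.update_self]
      exact (hA a).2 ha
    have hex : ∃ j, (a ⊓ n).update i j ∈ A := ⟨(a ⊓ n) i, hself⟩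
    have hle : Nat.find hex ≤ (a ⊓ n) i := Nat.find_min' hex hself
    have hgn : (a ⊓ n).update i (Nat.find hex) ≤ n := fun v => by
      by_cases hv : v = i
      · subst hv
        simpa using hle.trans (min_le_right _ _)
      · simp [hv]
    refine ⟨(a ⊓ n).update i (Nat.find hex), ⟨hgn, Nat.find_spec hex, fun j hj => ?_⟩,
      (mem_box_erase_iff hgn).2 ⟨?_, fun v hv => by simp [hv]⟩⟩
    · simpa using Nat.find_min' hex (by simpa using hj)
    · simpa using hle.trans (min_le_left _ _)

theorem pairwiseDisjoint_lineBottoms [DecidableEq V] (n : V →₀ ℕ) (A : Set (V →₀ ℕ)) (i : V) :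
    (lineBottoms n A i).PairwiseDisjoint fun g => box g ((n - g).support.erase i) := by
  rintro g ⟨hgn, hgA, hmin⟩ g' ⟨hgn', hgA', hmin'⟩ hne
  refine Set.disjoint_left.2 fun a ha ha' => hne ?_
  have heq : ∀ v ≠ i, g v = g' v := fun v hv => by
    rw [← ((mem_box_erase_iff hgn).1 ha).2 v hv, ← ((mem_box_erase_iff hgn').1 ha').2 v hv]
  have hupd : g.update i (g' i) = g' := by
    ext v
    by_cases hv : v = i <;> simp [hv, heq]
  have hupd' : g'.update i (g i) = g := by
    ext v
    by_cases hv : v = i <;> simp [hv, heq]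
  have hi : g i = g' i := (hmin _ (by rwa [hupd])).antisymm (hmin' _ (by rwa [hupd']))
  rw [← hupd, ← hi, Finsupp.update_self]

theorem DeterminedBy.boxPartition_one_of_add_single_mem (hA : DeterminedBy n A)
    (hn : n.support ⊆ C) {i : V} (hi : i ∈ C) (hadd : ∀ a ∈ A, ∀ j, a + Finsupp.single i j ∈ A) :
    BoxPartition C 1 A := by
  classical
  have hfin : (lineBottoms n A i).Finite := (Set.finite_Iic n).subset fun _ hg => hg.1
  have hpart := BoxPartition.biUnion (s := hfin.toFinset) (C := C) (d := 1)
    (A := fun g => box g ((n - g).support.erase i))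
    (by simpa only [hfin.coe_toFinset] using pairwiseDisjoint_lineBottoms n A i)
    fun g hg => ?_
  · simpa only [hfin.mem_toFinset, hA.iUnion_lineBottoms hadd] using hpart
  have hgn : g ≤ n := (hfin.mem_toFinset.1 hg).1
  have hF : (n - g).support.erase i ⊆ C.erase i :=
    Finset.erase_subset_erase i ((Finsupp.support_mono tsub_le_self).trans hn)
  refine .of_box ((Finsupp.support_mono hgn).trans hn) (hF.trans (Finset.erase_subset i C)) ?_
  rw [← Finset.card_erase_add_one hi]
  exact Nat.add_le_add_right (Finset.card_le_card hF) 1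

theorem inf_add_inf_eq (a b n : V →₀ ℕ) : (a ⊓ n + b) ⊓ n = (a + b) ⊓ n := by
  ext v
  simp only [Finsupp.inf_apply, Finsupp.add_apply]
  grind

theorem DeterminedBy.boxPartition_one (hA : DeterminedBy n A) (hn : n.support ⊆ C)
    (hconv : A.OrdConnected) (hfree : ∀ a ∈ A, ∃ i ∈ C, ∀ j, a + Finsupp.single i j ∈ A) :
    BoxPartition C 1 A := by
  classical
  let Free (a : V →₀ ℕ) (i : V) : Prop := ∀ j, a + Finsupp.single i j ∈ A
  have hdet : ∀ a i, Free (a ⊓ n) i ↔ Free a i := fun a i =>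
    forall_congr' fun j => hA.mem_congr (inf_add_inf_eq a _ n)
  -- By convexity, moving up inside `A` creates no new free direction.
  have hanti : ∀ a ∈ A, ∀ b, a ≤ b → ∀ i, Free b i → Free a i := fun a ha b hab i hb j =>
    hconv.out ha (hb j) ⟨le_self_add, by gcongr⟩
  have hpart : ∀ T ⊆ C, BoxPartition C 1 {a ∈ A | ∃ i ∈ T, Free a i} := by
    intro T
    induction T using Finset.induction_on with
    | empty => simpa using BoxPartition.empty
    | insert i T _ ih =>
      intro hT
      have hsplit : {a ∈ A | ∃ l ∈ insert i T, Free a l} =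
          {a ∈ A | ∃ l ∈ T, Free a l} ∪ {a ∈ A | Free a i ∧ ∀ l ∈ T, ¬ Free a l} := by
        ext a
        simp only [Set.mem_union, Set.mem_ofPred_eq, Finset.mem_insert]
        grind
      rw [hsplit]
      refine .union (Set.disjoint_left.2 ?_) (ih ((Finset.subset_insert i T).trans hT)) ?_
      · rintro a ⟨-, l, hl, hal⟩ ⟨-, -, hnot⟩
        exact hnot l hl hal
      refine boxPartition_one_of_add_single_mem (n := n) (fun a => ?_) hn
        (hT (Finset.mem_insert_self i T)) ?_
      · simp only [Set.mem_ofPred_eq, hA a, hdet]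
      · rintro a ⟨ha, hi, hnot⟩ j
        refine ⟨hi j, fun j' => ?_, fun l hl hal => hnot l hl (hanti a ha _ le_self_add l hal)⟩
        rw [add_assoc, ← Finsupp.single_add]
        exact hi (j + j')
  have hall : {a ∈ A | ∃ i ∈ C, Free a i} = A := Set.sep_eq_self_iff_mem_true.2 hfree
  exact hall ▸ hpart C subset_rfl

end BoxPartition

section EdgeOrder

variable {V : Type*} {G : SimpleGraph V}

/-- The exponent vectors of the generators `x_v x_w` of the edge ideal. The sumset
`k • edgeExponents G` (which is not a dilation) then consists of the exponent vectors of the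
generators of the `k`-th power. -/
def edgeExponents (G : SimpleGraph V) : Set (V →₀ ℕ) :=
  {e | ∃ v w, G.Adj v w ∧ Finsupp.single v 1 + Finsupp.single w 1 = e}

/-- The order of the monomial `x ^ a` along the edge ideal `I`, i.e. the largest `k` such that
`x ^ a ∈ I ^ k`. -/
noncomputable def edgeOrder (G : SimpleGraph V) (a : V →₀ ℕ) : ℕ :=
  sSup {k : ℕ | ∃ m ∈ k • edgeExponents G, m ≤ a}

theorem mem_succ_nsmul_edgeExponents {k : ℕ} {m : V →₀ ℕ} :
    m ∈ (k + 1) • edgeExponents G ↔ ∃ m' ∈ k • edgeExponents G, ∃ v w, G.Adj v w ∧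
      m' + (Finsupp.single v 1 + Finsupp.single w 1) = m := by
  rw [succ_nsmul, Set.mem_add]
  constructor
  · rintro ⟨m', hm', _, ⟨v, w, hvw, rfl⟩, hm⟩
    exact ⟨m', hm', v, w, hvw, hm⟩
  · rintro ⟨m', hm', v, w, hvw, hm⟩
    exact ⟨m', hm', _, ⟨v, w, hvw, rfl⟩, hm⟩

theorem add_edge_mem_nsmul_edgeExponents {k : ℕ} {m : V →₀ ℕ} (hm : m ∈ k • edgeExponents G)
    {v w : V} (hvw : G.Adj v w) :
    m + (Finsupp.single v 1 + Finsupp.single w 1) ∈ (k + 1) • edgeExponents G :=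
  mem_succ_nsmul_edgeExponents.2 ⟨m, hm, v, w, hvw, rfl⟩

theorem exists_adj_of_mem_nsmul_edgeExponents {k : ℕ} {m : V →₀ ℕ}
    (hm : m ∈ k • edgeExponents G) {v : V} (hv : m v ≠ 0) :
    ∃ l, k = l + 1 ∧ ∃ w, G.Adj v w ∧ ∃ m' ∈ l • edgeExponents G,
      m' + (Finsupp.single v 1 + Finsupp.single w 1) = m := by
  induction k generalizing m with
  | zero => simp_all
  | succ k ih =>
    obtain ⟨m₀, hm₀, x, y, hxy, rfl⟩ := mem_succ_nsmul_edgeExponents.1 hm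
    refine ⟨k, rfl, ?_⟩
    by_cases hvx : v = x
    · subst hvx
      exact ⟨y, hxy, m₀, hm₀, rfl⟩
    by_cases hvy : v = y
    · subst hvy
      exact ⟨x, hxy.symm, m₀, hm₀, by rw [add_comm (Finsupp.single v 1)]⟩
    obtain ⟨l, rfl, w, hvw, m₁, hm₁, rfl⟩ := ih hm₀ (by
      simpa [Finsupp.single_apply, Ne.symm hvx, Ne.symm hvy] using hv)
    exact ⟨w, hvw, _, add_edge_mem_nsmul_edgeExponents hm₁ hxy, add_right_comm _ _ _⟩

theorem mem_support_of_mem_nsmul_edgeExponents {k : ℕ} {m : V →₀ ℕ}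
    (hm : m ∈ k • edgeExponents G) {v : V} (hv : m v ≠ 0) : v ∈ G.support := by
  obtain ⟨-, -, w, hvw, -⟩ := exists_adj_of_mem_nsmul_edgeExponents hm hv
  exact ⟨w, hvw⟩

theorem apply_le_of_mem_nsmul_edgeExponents {k : ℕ} {m : V →₀ ℕ}
    (hm : m ∈ k • edgeExponents G) (v : V) : m v ≤ k := by
  classical
  induction k generalizing m with
  | zero => simp_all
  | succ k ih =>
    obtain ⟨m₀, hm₀, x, y, hxy, rfl⟩ := mem_succ_nsmul_edgeExponents.1 hm
    have := ih hm₀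
    simp only [Finsupp.add_apply, Finsupp.single_apply]
    grind [hxy.ne]

theorem degree_of_mem_nsmul_edgeExponents {k : ℕ} {m : V →₀ ℕ}
    (hm : m ∈ k • edgeExponents G) : m.degree = 2 * k := by
  induction k generalizing m with
  | zero => simp_all
  | succ k ih =>
    obtain ⟨m₀, hm₀, x, y, -, rfl⟩ := mem_succ_nsmul_edgeExponents.1 hm
    simp only [map_add, Finsupp.degree_single, ih hm₀]
    ring

theorem exists_mem_nsmul_edgeExponents_le {k l : ℕ} (hkl : k ≤ l) {m : V →₀ ℕ}
    (hm : m ∈ l • edgeExponents G) : ∃ m' ∈ k • edgeExponents G, m' ≤ m := by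
  obtain ⟨c, rfl⟩ := exists_add_of_le hkl
  rw [add_nsmul, Set.mem_add] at hm
  obtain ⟨m', hm', m'', -, rfl⟩ := hm
  exact ⟨m', hm', le_self_add⟩

theorem le_edgeOrder_iff {k : ℕ} {a : V →₀ ℕ} :
    k ≤ edgeOrder G a ↔ ∃ m ∈ k • edgeExponents G, m ≤ a := by
  have hbdd : BddAbove {k : ℕ | ∃ m ∈ k • edgeExponents G, m ≤ a} := by
    refine ⟨a.degree, fun k ⟨m, hm, hma⟩ => ?_⟩
    have := degree_of_mem_nsmul_edgeExponents hm
    have := Finsupp.degree_mono hma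
    omega
  have hne : {k : ℕ | ∃ m ∈ k • edgeExponents G, m ≤ a}.Nonempty := ⟨0, 0, by simp, zero_le⟩
  refine ⟨fun hk => ?_, fun hk => le_csSup hbdd hk⟩
  obtain ⟨m, hm, hma⟩ := Nat.sSup_mem hne hbdd
  obtain ⟨m', hm', hle⟩ := exists_mem_nsmul_edgeExponents_le hk hm
  exact ⟨m', hm', hle.trans hma⟩

theorem edgeOrder_mono : Monotone (edgeOrder G) := fun a b hab => by
  obtain ⟨m, hm, hma⟩ := le_edgeOrder_iff.1 (le_refl (edgeOrder G a))
  exact le_edgeOrder_iff.2 ⟨m, hm, hma.trans hab⟩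

theorem le_edgeOrder_inf_iff {n : V →₀ ℕ} {k : ℕ} (hn : ∀ v ∈ G.support, k ≤ n v)
    {a : V →₀ ℕ} : k ≤ edgeOrder G (a ⊓ n) ↔ k ≤ edgeOrder G a := by
  refine ⟨fun h => h.trans (edgeOrder_mono inf_le_left), fun h => ?_⟩
  obtain ⟨m, hm, hma⟩ := le_edgeOrder_iff.1 h
  refine le_edgeOrder_iff.2 ⟨m, hm, le_inf hma fun v => ?_⟩
  by_cases hv : m v = 0
  · simp [hv]
  · exact (apply_le_of_mem_nsmul_edgeExponents hm v).trans
      (hn v (mem_support_of_mem_nsmul_edgeExponents hm hv))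

theorem determinedBy_edgeOrder_eq {n : V →₀ ℕ} {k : ℕ} (hn : ∀ v ∈ G.support, k + 1 ≤ n v) :
    DeterminedBy n {a | edgeOrder G a = k} := fun a => by
  have hle := le_edgeOrder_inf_iff (a := a) fun v hv => (Nat.le_succ k).trans (hn v hv)
  have hlt := le_edgeOrder_inf_iff (a := a) hn
  simp only [Set.mem_ofPred_eq]
  omega

theorem ordConnected_edgeOrder_eq (k : ℕ) : {a | edgeOrder G a = k}.OrdConnected :=
  Set.ordConnected_singleton.preimage_mono edgeOrder_mono

end EdgeOrder

section Bipartite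

variable {V : Type*} {G : SimpleGraph V} {s t : Set V}

theorem degree_filter_of_mem_nsmul_edgeExponents (hG : G.IsBipartiteWith s t)
    [DecidablePred (· ∈ s)] {k : ℕ} {m : V →₀ ℕ} (hm : m ∈ k • edgeExponents G) :
    (m.filter (· ∈ s)).degree = k := by
  induction k generalizing m with
  | zero =>
    obtain rfl : m = 0 := by simpa using hm
    rw [Finsupp.filter_zero, map_zero]
  | succ k ih =>
    obtain ⟨m₀, hm₀, v, w, hvw, rfl⟩ := mem_succ_nsmul_edgeExponents.1 hm
    have hst := Set.disjoint_left.1 hG.disjoint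
    rcases hG.mem_of_adj hvw with ⟨hv, hw⟩ | ⟨hv, hw⟩
    · have hw' : w ∉ s := fun h => hst h hw
      simp [Finsupp.filter_add, Finsupp.filter_single_of_pos, Finsupp.filter_single_of_neg, hv,
        hw', ih hm₀]
    · have hv' : v ∉ s := fun h => hst h hv
      simp [Finsupp.filter_add, Finsupp.filter_single_of_pos, Finsupp.filter_single_of_neg, hw,
        hv', ih hm₀]

theorem exists_lt_apply_of_mem_nsmul_edgeExponents (hG : G.IsBipartiteWith s t) {k : ℕ}
    {m m' : V →₀ ℕ} (hm : m ∈ k • edgeExponents G) (hm' : m' ∈ (k + 1) • edgeExponents G) :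
    ∃ x ∈ s, m x < m' x := by
  classical
  by_contra! hle
  have hfilter : m'.filter (· ∈ s) ≤ m.filter (· ∈ s) := fun v => by
    by_cases hv : v ∈ s <;> simp [hv, hle]
  have hdeg := Finsupp.degree_mono hfilter
  rw [degree_filter_of_mem_nsmul_edgeExponents hG hm,
    degree_filter_of_mem_nsmul_edgeExponents hG hm'] at hdeg
  omega

theorem exists_augmentation (hG : G.IsBipartiteWith s t) {k : ℕ} {m m' : V →₀ ℕ}
    (hm : m ∈ k • edgeExponents G) (hm' : m' ∈ (k + 1) • edgeExponents G) :
    ∃ x ∈ s, ∃ y ∈ t, m x < m' x ∧ m y < m' y ∧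
      m + (Finsupp.single x 1 + Finsupp.single y 1) ∈ (k + 1) • edgeExponents G := by
  classical
  have hne : ∀ {v w : V}, v ∈ s → w ∈ t → v ≠ w := fun hv hw h =>
    Set.disjoint_left.1 hG.disjoint hv (h ▸ hw)
  obtain ⟨x, hx, hlt⟩ := exists_lt_apply_of_mem_nsmul_edgeExponents hG hm hm'
  obtain ⟨_, ⟨⟩, y, hxy, m'₀, hm'₀, hm'eq⟩ := exists_adj_of_mem_nsmul_edgeExponents hm' hlt.ne_bot
  have hy : y ∈ t := hG.mem_of_mem_adj hx hxy
  by_cases hlty : m y < m' y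
  · exact ⟨x, hx, y, hy, hlt, hlty, add_edge_mem_nsmul_edgeExponents hm hxy⟩
  have hm'_apply (v : V) :
      m' v = m'₀ v + ((if x = v then 1 else 0) + if y = v then 1 else 0) := by
    simp [← hm'eq, Finsupp.single_apply]
  -- Otherwise `m` uses an edge `x₁y`; drop it from `m`, and drop `xy` from `m'`.
  obtain ⟨l, rfl, x₁, hyx₁, m₀, hm₀, hmeq⟩ :=
    exists_adj_of_mem_nsmul_edgeExponents hm (v := y) (by grind)
  have hm_apply (v : V) :
      m v = m₀ v + ((if y = v then 1 else 0) + if x₁ = v then 1 else 0) := by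
    simp [← hmeq, Finsupp.single_apply]
  have hx₁ : x₁ ∈ s := hG.symm.mem_of_mem_adj hy hyx₁
  obtain ⟨x', hx', y', hy', hltx', hlty', hmem⟩ := exists_augmentation hG hm₀ hm'₀
  have hlty'' : m y' < m' y' := by
    have := hne hx hy'
    have := hne hx₁ hy'
    grind
  by_cases hxx : x' = x₁
  · refine ⟨x, hx, y', hy', hlt, hlty'', ?_⟩
    convert add_edge_mem_nsmul_edgeExponents hmem hxy using 1
    rw [← hmeq, hxx]
    abel
  · refine ⟨x', hx', y', hy', ?_, hlty'', ?_⟩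
    · have := hne hx' hy
      grind
    · convert add_edge_mem_nsmul_edgeExponents hmem hyx₁ using 1
      rw [← hmeq]
      abel

theorem edgeOrder_add_single_eq (hG : G.IsBipartiteWith s t) {a m : V →₀ ℕ}
    (hm : m ∈ edgeOrder G a • edgeExponents G) (hma : m ≤ a) {i : V}
    (hi : m i < a i ∨ ∀ v ∈ G.support, a v ≤ m v) (j : ℕ) :
    edgeOrder G (a + Finsupp.single i j) = edgeOrder G a := by
  classical
  refine (Nat.le_of_not_lt fun hlt => ?_).antisymm (edgeOrder_mono le_self_add)
  obtain ⟨m', hm', hle⟩ := le_edgeOrder_iff.1 hlt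
  obtain ⟨x, hx, y, hy, hmx, hmy, hmem⟩ := exists_augmentation hG hm hm'
  have hxy : x ≠ y := fun h => Set.disjoint_left.1 hG.disjoint hx (h ▸ hy)
  have hx₀ := mem_support_of_mem_nsmul_edgeExponents hm' hmx.ne_bot
  have hy₀ := mem_support_of_mem_nsmul_edgeExponents hm' hmy.ne_bot
  have hm'a : ∀ v ≠ i, m' v ≤ a v := fun v hv => by
    simpa [Finsupp.single_apply, hv.symm] using hle v
  rcases hi with hi | hsat
  · refine (edgeOrder G a).lt_irrefl (le_edgeOrder_iff.2 ⟨_, hmem, fun v => ?_⟩)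
    have := hma v
    by_cases hv : v = i
    · subst hv
      simp only [Finsupp.add_apply, Finsupp.single_apply]
      grind
    · have := hm'a v hv
      simp only [Finsupp.add_apply, Finsupp.single_apply]
      grind
  · grind

theorem exists_forall_edgeOrder_add_single_eq (hG : G.IsBipartiteWith s t) {T : Set V}
    (hT : T.Nonempty) (hGT : G.support ⊆ T) (a : V →₀ ℕ) :
    ∃ i ∈ T, ∀ j, edgeOrder G (a + Finsupp.single i j) = edgeOrder G a := by
  obtain ⟨m, hm, hma⟩ := le_edgeOrder_iff.1 (le_refl (edgeOrder G a))
  by_cases hlt : ∃ i ∈ T, m i < a i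
  · obtain ⟨i, hi, hlt⟩ := hlt
    exact ⟨i, hi, edgeOrder_add_single_eq hG hm hma (.inl hlt)⟩
  · push Not at hlt
    obtain ⟨i, hi⟩ := hT
    exact ⟨i, hi, edgeOrder_add_single_eq hG hm hma (.inr fun v hv => hlt v (hGT hv))⟩

end Bipartite

section BipartiteBoxes

variable {V : Type*} {G : SimpleGraph V} {C : Finset V}

theorem determinedBy_indicator_edgeOrder_eq (hGC : G.support ⊆ C) (k : ℕ) :
    DeterminedBy (Finsupp.indicator C fun _ _ => k + 1) {a | edgeOrder G a = k} := by
  classical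
  refine determinedBy_edgeOrder_eq fun v hv => ?_
  rw [Finsupp.indicator_of_mem (Finset.mem_coe.1 (hGC hv))]

theorem boxPartition_zero_edgeOrder (hGC : G.support ⊆ C) (k : ℕ) :
    BoxPartition C 0 {a | edgeOrder G a = k} :=
  (determinedBy_indicator_edgeOrder_eq hGC k).boxPartition_zero
    (Finsupp.support_indicator_subset _ _)

theorem boxPartition_one_edgeOrder (hG : G.IsBipartite) (hC : C.Nonempty)
    (hGC : G.support ⊆ C) (k : ℕ) : BoxPartition C 1 {a | edgeOrder G a = k} := by
  obtain ⟨s, t, hst⟩ := hG.exists_isBipartiteWith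
  refine (determinedBy_indicator_edgeOrder_eq hGC k).boxPartition_one
    (Finsupp.support_indicator_subset _ _) (ordConnected_edgeOrder_eq k) ?_
  rintro a rfl
  exact exists_forall_edgeOrder_add_single_eq hst hC hGC a

end BipartiteBoxes

section Components

variable {V : Type*} {G : SimpleGraph V}

theorem edgeExponents_mono : Monotone (edgeExponents : SimpleGraph V → Set (V →₀ ℕ)) :=
  fun _ _ h _ ⟨v, w, hvw, he⟩ => ⟨v, w, h hvw, he⟩

theorem apply_eq_zero_of_mem_nsmul_edgeExponents {D : G.ConnectedComponent} {k : ℕ}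
    {m : V →₀ ℕ} (hm : m ∈ k • edgeExponents D.toSimpleGraph.spanningCoe) {v : V}
    (hv : D ≠ G.connectedComponentMk v) : m v = 0 := by
  by_contra h
  obtain ⟨w, hvw⟩ := mem_support_of_mem_nsmul_edgeExponents hm h
  exact hv (D.adj_spanningCoe_toSimpleGraph.1 hvw).1.symm

theorem le_sum_edgeOrder_of_mem_nsmul_edgeExponents [Fintype G.ConnectedComponent] {k : ℕ}
    {m : V →₀ ℕ} (hm : m ∈ k • edgeExponents G) :
    k ≤ ∑ D : G.ConnectedComponent, edgeOrder D.toSimpleGraph.spanningCoe m := by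
  induction k generalizing m with
  | zero => exact Nat.zero_le _
  | succ k ih =>
    obtain ⟨m₀, hm₀, v, w, hvw, rfl⟩ := mem_succ_nsmul_edgeExponents.1 hm
    refine Nat.succ_le_of_lt ((ih hm₀).trans_lt (Finset.sum_lt_sum
      (fun D _ => edgeOrder_mono le_self_add) ⟨G.connectedComponentMk v, Finset.mem_univ _, ?_⟩))
    obtain ⟨m', hm', hle⟩ := le_edgeOrder_iff.1
      (le_refl (edgeOrder (G.connectedComponentMk v).toSimpleGraph.spanningCoe m₀))
    have hadj := (G.connectedComponentMk v).adj_spanningCoe_toSimpleGraph.2 ⟨rfl, hvw⟩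
    exact le_edgeOrder_iff.2
      ⟨_, add_edge_mem_nsmul_edgeExponents hm' hadj, add_le_add_left hle _⟩

theorem edgeOrder_eq_sum [Fintype G.ConnectedComponent] (a : V →₀ ℕ) :
    edgeOrder G a = ∑ D : G.ConnectedComponent, edgeOrder D.toSimpleGraph.spanningCoe a := by
  classical
  apply le_antisymm
  · obtain ⟨m, hm, hma⟩ := le_edgeOrder_iff.1 (le_refl (edgeOrder G a))
    exact (le_sum_edgeOrder_of_mem_nsmul_edgeExponents hm).trans
      (Finset.sum_le_sum fun D _ => edgeOrder_mono hma)
  · have hex (D : G.ConnectedComponent) :=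
      le_edgeOrder_iff.1 (le_refl (edgeOrder D.toSimpleGraph.spanningCoe a))
    choose m hm hma using hex
    refine le_edgeOrder_iff.2 ⟨∑ D, m D, ?_, fun v => ?_⟩
    · rw [← Finset.sum_nsmul_assoc]
      exact Set.finsetSum_mem_finsetSum _ _ _ fun D _ => Set.nsmul_subset_nsmul_left
        (edgeExponents_mono (SimpleGraph.spanningCoe_induce_le G D.supp)) (hm D)
    · rw [Finsupp.finsetSum_apply, Finset.sum_eq_single_of_mem (G.connectedComponentMk v)
        (Finset.mem_univ _) fun D _ hD => apply_eq_zero_of_mem_nsmul_edgeExponents (hm D) hD]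
      exact hma _ v

open Classical in
theorem boxPartition_edgeOrder_component [Fintype V] (D : G.ConnectedComponent) (k : ℕ) :
    BoxPartition D.supp.toFinset (if D.toSimpleGraph.IsBipartite then 1 else 0)
      {a | edgeOrder D.toSimpleGraph.spanningCoe a = k} := by
  have hsupp : D.toSimpleGraph.spanningCoe.support ⊆ (D.supp.toFinset : Set V) := by
    rintro v ⟨w, hvw⟩
    simpa using (D.adj_spanningCoe_toSimpleGraph.1 hvw).1
  split_ifs with hD
  · exact boxPartition_one_edgeOrder (hD.map _) (Set.toFinset_nonempty.2 D.nonempty_supp) hsupp k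
  · exact boxPartition_zero_edgeOrder hsupp k

theorem boxPartition_edgeOrder [Fintype V] (G : SimpleGraph V) (k : ℕ) :
    BoxPartition Finset.univ (numBipartiteComponents G) {a | edgeOrder G a = k} := by
  classical
  have hsplit : {a | edgeOrder G a = k} = ⋃ κ ∈ Finset.piAntidiag Finset.univ k,
      ⋂ D ∈ Finset.univ, {a | edgeOrder (D : G.ConnectedComponent).toSimpleGraph.spanningCoe a =
        κ D} := by
    ext a
    rw [Set.mem_ofPred_eq, edgeOrder_eq_sum a]
    simp [← funext_iff]
  have hdisj : ((Finset.univ : Finset G.ConnectedComponent) : Set _).PairwiseDisjoint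
      fun D : G.ConnectedComponent => D.supp.toFinset := fun D _ D' _ hne =>
    Set.disjoint_toFinset.2 (G.pairwise_disjoint_supp_connectedComponent hne)
  have huniv : Finset.univ.biUnion (fun D : G.ConnectedComponent => D.supp.toFinset) =
      Finset.univ := by
    ext v
    simp
  have hcard : ∑ D : G.ConnectedComponent, (if D.toSimpleGraph.IsBipartite then 1 else 0) =
      numBipartiteComponents G := by
    rw [numBipartiteComponents, Nat.card_eq_fintype_card, Fintype.card_subtype,
      Finset.card_filter]
  rw [hsplit, ← huniv, ← hcard]
  refine .biUnion (fun κ _ κ' _ hne => Set.disjoint_left.2 fun a ha ha' => hne ?_) fun κ _ =>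
    .biInter hdisj fun D _ => boxPartition_edgeOrder_component D (κ D)
  ext D
  simp only [Set.mem_iInter] at ha ha'
  exact (ha D (Finset.mem_univ D)).symm.trans (ha' D (Finset.mem_univ D))

end Components

section Monomials

theorem toSubmodule_supported_eq_restrictSupport {σ R : Type*} [CommSemiring R] (Z : Set σ) :
    Subalgebra.toSubmodule (supported R Z) = restrictSupport R {b | ↑b.support ⊆ Z} := by
  ext f
  rw [Subalgebra.mem_toSubmodule, mem_supported, mem_restrictSupport_iff]
  constructor
  · exact fun h b hb v hv => h ((mem_vars_iff_mem_support v).2 ⟨b, hb, hv⟩)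
  · intro h v hv
    obtain ⟨b, hb, hvb⟩ := (mem_vars_iff_mem_support v).1 hv
    exact h hb hvb

theorem span_monomial_image_pow {σ R : Type*} [CommSemiring R] (A : Set (σ →₀ ℕ)) (k : ℕ) :
    Ideal.span ((monomial · (1 : R)) '' A) ^ k = Ideal.span ((monomial · 1) '' (k • A)) := by
  have himage (B : Set (σ →₀ ℕ)) : (monomial · (1 : R)) '' (B + A) =
      ((monomial · 1) '' B) * ((monomial · 1) '' A) :=
    Set.image_image2_distrib fun a b => by simp [monomial_mul]
  induction k with
  | zero => simp
  | succ k ih => rw [pow_succ, succ_nsmul, ih, himage, Ideal.span_mul_span']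

end Monomials

section StanleySpace

theorem isInternal_span_image {R M ι κ : Type*} [Ring R] [AddCommGroup M] [Module R M]
    [DecidableEq κ] {v : ι → M} (hv : LinearIndependent R v)
    (hspan : ⊤ ≤ Submodule.span R (Set.range v)) {B : κ → Set ι}
    (hB : Pairwise (Function.onFun Disjoint B)) (hcover : ⋃ i, B i = Set.univ) :
    DirectSum.IsInternal fun i => Submodule.span R (v '' B i) := by
  refine DirectSum.isInternal_submodule_of_iSupIndep_of_iSup_eq_top (fun i => ?_) ?_
  · have hrest : ⨆ (j) (_ : j ≠ i), Submodule.span R (v '' B j) =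
        Submodule.span R (v '' ⋃ (j) (_ : j ≠ i), B j) := by
      simp only [Set.image_iUnion, Submodule.span_iUnion]
    rw [hrest]
    refine hv.disjoint_span_image ?_
    simp only [Set.disjoint_iUnion_right]
    exact fun j hj => hB hj.symm
  · rw [← Submodule.span_iUnion, ← Set.image_iUnion, hcover, Set.image_univ]
    exact top_le_iff.1 hspan

variable {σ K M : Type*} [Field K] [AddCommGroup M] [Module K M] [Module (MvPolynomial σ K) M]
  [IsScalarTower K (MvPolynomial σ K) M]

theorem stanleySpace_eq_span (u : M) (Z : Finset σ) :
    stanleySpace u Z =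
      Submodule.span K ((fun b => monomial b (1 : K) • u) '' {b | b.support ⊆ Z}) := by
  rw [stanleySpace, toSubmodule_supported_eq_restrictSupport, restrictSupport_eq_span,
    Submodule.map_span, Set.image_image]
  simp

end StanleySpace

section MonomialIdeals

variable {V K : Type*} [Field K] {P Q : Set (V →₀ ℕ)}

variable (K) in
/-- The class of the monomial `x ^ a` in `J / L`, where `J` and `L` are the monomial ideals with
exponent sets `P` and `Q`. These classes form a `K`-basis of `J / L`. -/
noncomputable def monomialClass (hP : IsUpperSet P) (hQ : IsUpperSet Q) (a : ↥(P \ Q)) :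
    IdealQuot (restrictSupportIdeal K P hP) (restrictSupportIdeal K Q hQ) :=
  Submodule.Quotient.mk ⟨monomial a 1, (monomial_mem_restrictSupport K).2 (.inl a.2.1)⟩

variable {hP : IsUpperSet P} {hQ : IsUpperSet Q}

theorem mk_restrictSupportIdeal_eq_zero_iff {f : restrictSupportIdeal K P hP} :
    (Submodule.Quotient.mk f : IdealQuot _ (restrictSupportIdeal K Q hQ)) = 0 ↔
      (f : MvPolynomial V K) ∈ restrictSupport K Q :=
  Submodule.Quotient.mk_eq_zero _

theorem linearIndependent_monomialClass : LinearIndependent K (monomialClass K hP hQ) := by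
  classical
  refine linearIndependent_iff'.2 fun s c hc a ha => by_contra fun hca => a.2.2 ?_
  have hsum : ∑ b ∈ s, c b • monomialClass K hP hQ b = Submodule.Quotient.mk
      (∑ b ∈ s, c b • ⟨monomial b 1, (monomial_mem_restrictSupport K).2 (.inl b.2.1)⟩) := by
    rw [← Submodule.mkQ_apply, map_sum]
    rfl
  rw [hsum, mk_restrictSupportIdeal_eq_zero_iff, mem_restrictSupport_iff] at hc
  refine hc (Finset.mem_coe.2 (mem_support_iff.2 ?_))
  simpa [coeff_sum, coeff_monomial, Subtype.coe_inj, ha] using hca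

theorem span_monomialClass : ⊤ ≤ Submodule.span K (Set.range (monomialClass K hP hQ)) := by
  set S := Submodule.span K (Set.range (monomialClass K hP hQ))
  have hle : restrictSupport K P ≤
      (S.comap ((Submodule.mkQ _).restrictScalars K)).map
        ((restrictSupportIdeal K P hP).subtype.restrictScalars K) := by
    rw [restrictSupport_eq_span, Submodule.span_le]
    rintro _ ⟨a, ha, rfl⟩
    let f : restrictSupportIdeal K P hP :=
      ⟨monomial a 1, (monomial_mem_restrictSupport K).2 (.inl ha)⟩
    refine ⟨f, ?_, rfl⟩
    by_cases haQ : a ∈ Q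
    · have hzero : (Submodule.Quotient.mk f : IdealQuot _ (restrictSupportIdeal K Q hQ)) = 0 :=
        mk_restrictSupportIdeal_eq_zero_iff.2 ((monomial_mem_restrictSupport K).2 (.inl haQ))
      exact (congrArg (· ∈ S) hzero).mpr S.zero_mem
    · exact Submodule.subset_span ⟨⟨a, ha, haQ⟩, rfl⟩
  rintro x -
  obtain ⟨⟨f, hf⟩, rfl⟩ := Submodule.Quotient.mk_surjective _ x
  obtain ⟨g, hg, hgf⟩ := hle hf
  obtain rfl : g = ⟨f, hf⟩ := Subtype.ext hgf
  exact hg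

theorem monomial_smul_monomialClass {a b : V →₀ ℕ} (ha : a ∈ P \ Q) (hab : b + a ∈ P \ Q) :
    monomial b (1 : K) • monomialClass K hP hQ ⟨a, ha⟩ = monomialClass K hP hQ ⟨b + a, hab⟩ := by
  rw [monomialClass, monomialClass, ← Submodule.Quotient.mk_smul]
  congr 1
  exact Subtype.ext (by simp)

theorem stanleySpace_monomialClass [Fintype V] [DecidableEq V] {a : ↥(P \ Q)} {F : Finset V}
    (h : box (a : V →₀ ℕ) F ⊆ P \ Q) :
    stanleySpace (monomialClass K hP hQ a) Fᶜ =
      Submodule.span K (monomialClass K hP hQ '' (Subtype.val ⁻¹' box (a : V →₀ ℕ) F)) := by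
  rw [stanleySpace_eq_span]
  congr 1
  ext x
  constructor
  · rintro ⟨b, hb, rfl⟩
    exact ⟨⟨b + a, h (add_mem_box_iff.2 hb)⟩, add_mem_box_iff.2 hb,
      (monomial_smul_monomialClass a.2 _).symm⟩
  · rintro ⟨⟨c, hc⟩, hcF, rfl⟩
    obtain ⟨b, rfl⟩ := le_iff_exists_add'.1 hcF.1
    exact ⟨b, add_mem_box_iff.1 hcF, monomial_smul_monomialClass a.2 hc⟩

theorem eq_zero_of_smul_monomialClass_eq_zero [Fintype V] [DecidableEq V] {a : ↥(P \ Q)}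
    {F : Finset V} (h : box (a : V →₀ ℕ) F ⊆ P \ Q) {f : MvPolynomial V K}
    (hf : f ∈ supported K (↑Fᶜ : Set V)) (h0 : f • monomialClass K hP hQ a = 0) : f = 0 := by
  by_contra hne
  obtain ⟨b, hb⟩ := support_nonempty.2 hne
  have hbF : b.support ⊆ Fᶜ := by
    rw [← Subalgebra.mem_toSubmodule, toSubmodule_supported_eq_restrictSupport] at hf
    exact Finset.coe_subset.1 (hf hb)
  rw [monomialClass, ← Submodule.Quotient.mk_smul, mk_restrictSupportIdeal_eq_zero_iff,
    mem_restrictSupport_iff] at h0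
  refine (h (add_mem_box_iff.2 hbF)).2 (h0 (Finset.mem_coe.2 (mem_support_iff.2 ?_)))
  simpa using hb

theorem le_sdepth_of_boxPartition [Fintype V] {d : ℕ}
    (h : BoxPartition Finset.univ d (P \ Q)) :
    (d : ℕ∞) ≤ sdepth (quotGrading (restrictSupportIdeal K P hP)
      (restrictSupportIdeal K Q hQ)) := by
  classical
  obtain ⟨r, u, F, hcard, hdisj, hcover⟩ := h.exists_boxes
  have hsub (i : Fin r) : box (u i) (F i) ⊆ P \ Q :=
    hcover ▸ Set.subset_iUnion (fun j => box (u j) (F j)) i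
  have hu (i : Fin r) : u i ∈ P \ Q := hsub i ⟨le_rfl, fun _ _ => rfl⟩
  let D : StanleyDecomposition (quotGrading (restrictSupportIdeal K P hP)
      (restrictSupportIdeal K Q hQ)) :=
    { r := r
      u := fun i => monomialClass K hP hQ ⟨u i, hu i⟩
      Z := fun i => (F i)ᶜ
      homogeneous := fun i => ⟨_, _, isWeightedHomogeneous_monomial _ (u i) 1 rfl, rfl⟩
      free := fun i f hf => eq_zero_of_smul_monomialClass_eq_zero (hsub i) hf
      isInternal := by
        simp only [stanleySpace_monomialClass (a := ⟨u _, hu _⟩) (hsub _)]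
        refine isInternal_span_image linearIndependent_monomialClass span_monomialClass
          (fun i j hij => (hdisj hij).preimage _) ?_
        rw [← Set.preimage_iUnion, hcover, Subtype.coe_preimage_self] }
  refine le_iSup_of_le D (le_iInf fun i => ?_)
  have hd : d ≤ #(F i)ᶜ := by
    rw [Finset.card_compl, ← Finset.card_univ]
    exact Nat.le_sub_of_add_le' (hcard i)
  exact_mod_cast hd

end MonomialIdeals

section EdgeIdealPow

variable {V : Type*} (K : Type*) [Field K]

theorem edgeIdeal_eq_span (G : SimpleGraph V) :
    edgeIdeal K G = Ideal.span ((monomial · 1) '' edgeExponents G) := by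
  rw [edgeIdeal]
  congr 1
  ext f
  constructor
  · rintro ⟨v, w, h, rfl⟩
    exact ⟨_, ⟨v, w, h, rfl⟩, by simp [X, monomial_mul]⟩
  · rintro ⟨_, ⟨v, w, h, rfl⟩, rfl⟩
    exact ⟨v, w, h, by simp [X, monomial_mul]⟩

theorem isUpperSet_le_edgeOrder (G : SimpleGraph V) (k : ℕ) : IsUpperSet {a | k ≤ edgeOrder G a} :=
  fun _ _ hab h => h.trans (edgeOrder_mono hab)

theorem edgeIdeal_pow_eq_restrictSupportIdeal (G : SimpleGraph V) (k : ℕ) :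
    edgeIdeal K G ^ k = restrictSupportIdeal K _ (isUpperSet_le_edgeOrder G k) := by
  ext f
  rw [edgeIdeal_eq_span, span_monomial_image_pow, mem_ideal_span_monomial_image]
  exact forall₂_congr fun a _ => le_edgeOrder_iff.symm

end EdgeIdealPow

theorem theorem2p2 {K : Type*} [Field K] {V : Type*} [Finite V] (G : SimpleGraph V) (k : ℕ) :
    (numBipartiteComponents G : ℕ∞) ≤
      sdepth (quotGrading (edgeIdeal K G ^ k) (edgeIdeal K G ^ (k + 1))) := by
  have := Fintype.ofFinite V
  have hdiff : {a | k ≤ edgeOrder G a} \ {a | k + 1 ≤ edgeOrder G a} = {a | edgeOrder G a = k} := by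
    ext a
    simp only [Set.mem_sdiff, Set.mem_ofPred_eq]
    omega
  rw [edgeIdeal_pow_eq_restrictSupportIdeal K G k,
    edgeIdeal_pow_eq_restrictSupportIdeal K G (k + 1)]
  exact le_sdepth_of_boxPartition (hdiff ▸ boxPartition_edgeOrder G k)
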